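/- **Setting.** Fix a nonempty set $K$ of colors and a set $V$ of variables. A *high-level Petri net* $N=(P,T,F,g,\mathcal M_0)$ consists of places $P$, transitions $T$, a flow function assigning to each $t\in T$ finite multisets ${}^\bullet t,t^\bullet$ over $P\times V$, a guard $g(t)$, i.e. a predicate on the variables $V(t)$ occurring in ${}^\bullet t$ or $t^\bullet$, and a nonempty set $\mathcal M_0$ of initial markings which all put the same number of colors on each place. Markings are finite multisets over $P\times K$. A mode of $t$ is a map $\sigma:V(t)\to K$ satisfying $g(t)$; $t$ is enabled in mode $\sigma$ at $M$, written $M[t,\sigma\rangle$, if ${}^\bullet(t,\sigma)\le M$, where ${}^\bullet(t,\sigma)$ and $(t,\sigma)^\bullet$ are obtained from ${}^\bullet t,t^\bullet$ by replacing each variable $v$ by $\sigma(v)$; firing then gives $(M-{}^\bullet(t,\sigma))+(t,\sigma)^\bullet$. $\mathcal R(N)$ is the set of markings reachable from $\mathcal M_0$ by finite firing sequences. A homomorphism of nets maps places to places and transitions to transitions, and preserves guards, presets and postsets (the latter two as multisets, with their variables); it is initial if it maps the set of initial markings onto the set of initial markings. Write $x\to y$ if there is an arc from node $x$ to node $y$,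 let $<$ and $\le$ be the transitive and the reflexive transitive closure of $\to$, and write $x\,\sharp\,y$ if there are a place $p$ and transitions $t\ne t'$ with $p\to t$, $p\to t'$, $t\le x$, $t'\le y$. An *occurrence net* (its places are called conditions, its transitions events) is a high-level Petri net with at most one arc from any node to any other, no event $e$ with $e\,\sharp\,e$, with $<$ irreflexive and well-founded, and such that each condition either carries exactly one color in every initial marking and has no incoming arc, or carries no color in any initial marking and has exactly one incoming arc. Let $B_0$ be the set of initially occupied conditions. Introduce indexed variables $v_e$ ($e$ an event, $v\in V(e)$) and $v^b_\bot$ ($b\in B_0$), and let $\mathbf v(b)$ be $v_e$ if $b$ has the incoming arc $(e,v,b)$, and $v^b_\bot$ if $b\in B_0$. The predicate $\mathrm{pred}(\bot)$ says that the values of the $v^b_\bot$ are given by some initial marking; $\mathrm{pred}(e)$ says that $\mathrm{pred}(\bot)$ holds and that for each event $e'\le e$ the values $(v_{e'})_v$ satisfy the guard of $e'$ and $v_{e'}=\mathbf v(b)$ for each $(b,v)\in{}^\bullet e'$. A *symbolic branching process* of $N$ is a pair $(O,h)$ of an occurrence net $O$ in which $\mathrm{pred}(e)$ is satisfiable for every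 event $e$, and an initial homomorphism $h:O\to N$ such that any two events with equal presets and equal images under $h$ are equal. $(O,h)$ is a prefix of $(O',h')$ if there is an injective initial homomorphism $\varphi:O\to O'$ with $h'\circ\varphi=h$. A *symbolic unfolding* of $N$ is a symbolic branching process that is maximal with respect to the prefix relation. A *configuration* $C$ is a set of events that is closed under causal predecessors, contains no events $e,e'$ with $e\,\sharp\,e'$, and for which the predicates of all its events are jointly satisfiable. An *instantiation* $\theta$ of $C$ assigns colors to the indexed variables of $C\cup\{\bot\}$ so that $\mathrm{pred}(\bot)$ and $\mathrm{pred}(e)$, $e\in C$, hold. Let $\mathrm{Cut}(C)$ be the set of conditions that lie in $B_0$ or have an incoming arc from $C$, and have no arc to an event of $C$. Let $\mathrm{Cut}(C,\theta)=\{(b,\theta(\mathbf v(b))) : b\in\mathrm{Cut}(C)\}$, viewed as a marking of $O$, and let $M(C,\theta)$ be the multiset $\{\!|\,(h(b),k) : (b,k)\in\mathrm{Cut}(C,\theta)\,|\!\}$. **Proposition.** Let $N$ be a high-level Petri net and $(O,h)$ a symbolic unfolding of $N$. 1. Suppose that every transition of $N$ which has a mode and has empty preset also has empty postset (in particular this holds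 if all presets are nonempty). Then $$\mathcal R(N)=\{M(C,\theta) : C\text{ a finite configuration of }O,\ \theta\text{ an instantiation of }C\}.$$ 2. For every configuration $C$ of $O$ with finite cut (in particular for every finite configuration), every instantiation $\theta$ of $C$, every transition $t$ of $N$ and every mode $\sigma$ of $t$, $$M(C,\theta)[t,\sigma\rangle\iff\text{there is an event } e \text{ of } O \text{ with } h(e)=t \text{ and } \mathrm{Cut}(C,\theta)[e,\sigma\rangle .$$ -/

import Mathlib

universe u

/-- A high-level Petri net over colors `K` and variables `V`, with places `P` and transitions `T`.
The flow function is given by the finite multisets `pre t`, `post t`: the multiplicity of `(p, v)`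
in `pre t` is the weight of the arc `(p, v, t)`, and its multiplicity in `post t` is the weight of
the arc `(t, v, p)`. A guard is given by its truth value under assignments of colors to variables;
it depends only on the variables occurring on arcs at the transition. -/
structure HLNet (K V P T : Type u) where
  pre : T → Multiset (P × V)
  post : T → Multiset (P × V)
  guard : T → (V → K) → Prop
  guard_congr : ∀ (t : T) (σ σ' : V → K),
    (∀ (p : P) (v : V), (p, v) ∈ pre t ∨ (p, v) ∈ post t → σ v = σ' v) →
      (guard t σ ↔ guard t σ')
  /-- the set of initial markings -/
  init : Set (Multiset (P × K))
  init_nonempty : init.Nonempty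
  /-- in all initial markings, the same places carry the same number of colors -/
  init_places : ∀ M ∈ init, ∀ M' ∈ init, M.map Prod.fst = M'.map Prod.fst

namespace HLNet

variable {K V P T P' T' : Type u}

/-- `σ` is a firing mode of `t`: the guard holds. (Modes are represented by total assignments;
only the values on the variables at arcs of `t` matter.) -/
def IsMode (N : HLNet K V P T) (t : T) (σ : V → K) : Prop := N.guard t σ

/-- The tokens consumed by firing `t` in mode `σ`. -/
def preMode (N : HLNet K V P T) (t : T) (σ : V → K) : Multiset (P × K) :=
  (N.pre t).map fun x => (x.1, σ x.2)

/-- The tokens produced by firing `t` in mode `σ`. -/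
def postMode (N : HLNet K V P T) (t : T) (σ : V → K) : Multiset (P × K) :=
  (N.post t).map fun x => (x.1, σ x.2)

/-- `M[t,σ⟩`: the transition `t` can fire in mode `σ` from the marking `M`. -/
def Enabled (N : HLNet K V P T) (M : Multiset (P × K)) (t : T) (σ : V → K) : Prop :=
  N.IsMode t σ ∧ N.preMode t σ ≤ M

open Classical in
/-- The marking obtained from `M` by firing `t` in mode `σ`. -/
noncomputable def fire (N : HLNet K V P T) (M : Multiset (P × K)) (t : T) (σ : V → K) :
    Multiset (P × K) :=
  (M - N.preMode t σ) + N.postMode t σ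

/-- Markings reachable by a finite firing sequence from some initial marking. -/
inductive Reachable (N : HLNet K V P T) : Multiset (P × K) → Prop
  | init {M : Multiset (P × K)} : M ∈ N.init → Reachable N M
  | step {M : Multiset (P × K)} {t : T} {σ : V → K} :
      Reachable N M → N.Enabled M t σ → Reachable N (N.fire M t σ)

/-- Homomorphisms of net structures, given by a map on places and a map on transitions. -/
structure IsHom (N : HLNet K V P T) (N' : HLNet K V P' T') (f : P → P') (g : T → T') : Prop where
  guard_eq : ∀ t, N.guard t = N'.guard (g t)
  pre_eq : ∀ t, N'.pre (g t) = (N.pre t).map fun x => (f x.1, x.2)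
  post_eq : ∀ t, N'.post (g t) = (N.post t).map fun x => (f x.1, x.2)

/-- Initial homomorphisms: the initial markings are mapped onto the initial markings. -/
structure IsInitialHom (N : HLNet K V P T) (N' : HLNet K V P' T') (f : P → P') (g : T → T') : Prop
    extends IsHom N N' f g where
  init_eq : (fun M : Multiset (P × K) => M.map fun x => (f x.1, x.2)) '' N.init = N'.init

/-- The relation `x → y` on nodes: there is an arc from `x` to `y`. -/
def Flow (N : HLNet K V P T) : P ⊕ T → P ⊕ T → Prop
  | Sum.inl p, Sum.inr t => ∃ v, (p, v) ∈ N.pre t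
  | Sum.inr t, Sum.inl p => ∃ v, (p, v) ∈ N.post t
  | _, _ => False

/-- Causality `x < y`. -/
def Lt (N : HLNet K V P T) : P ⊕ T → P ⊕ T → Prop := Relation.TransGen N.Flow

/-- Reflexive causality `x ≤ y`. -/
def Le (N : HLNet K V P T) : P ⊕ T → P ⊕ T → Prop := Relation.ReflTransGen N.Flow

/-- Structural conflict `x ♯ y`. -/
def Conflict (N : HLNet K V P T) (x y : P ⊕ T) : Prop :=
  ∃ (p : P) (t t' : T), t ≠ t' ∧ N.Flow (Sum.inl p) (Sum.inr t) ∧ N.Flow (Sum.inl p) (Sum.inr t') ∧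
    N.Le (Sum.inr t) x ∧ N.Le (Sum.inr t') y

/-- At most one arc (counted with multiplicity) between any two nodes in either direction. -/
def Ordinary (N : HLNet K V P T) : Prop :=
  ∀ t, ((N.pre t).map Prod.fst).Nodup ∧ ((N.post t).map Prod.fst).Nodup

open Classical in
/-- High-level occurrence nets. The number of tokens on `b` in `M` is
`(M.map Prod.fst).count b`. -/
structure IsOccurrenceNet {B E : Type u} (O : HLNet K V B E) : Prop where
  ordinary : O.Ordinary
  no_self_conflict : ∀ e : E, ¬ O.Conflict (Sum.inr e) (Sum.inr e)
  irrefl : ∀ x, ¬ O.Lt x x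
  wellFounded : WellFounded O.Lt
  origin : ∀ b : B, Xor
    ((∀ M ∈ O.init, (M.map Prod.fst).count b = 1) ∧ ∀ e, ¬ O.Flow (Sum.inr e) (Sum.inl b))
    ((∀ M ∈ O.init, (M.map Prod.fst).count b = 0) ∧ ∃! ev : E × V, (b, ev.2) ∈ O.post ev.1)

end HLNet

/-- Indexed variables: `v_e` for an event `e`, and `v^b_⊥` for the special initial event `⊥`. -/
inductive IVar (V B E : Type u) : Type u
  | event (e : E) (v : V) : IVar V B E
  | bot (b : B) : IVar V B E

namespace HLNet

variable {K V B E : Type u}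

/-- The conditions occupied in the initial cuts. -/
def initConds (O : HLNet K V B E) : Set B := {b | ∃ M ∈ O.init, ∃ k, (b, k) ∈ M}

open Classical in
/-- The indexed variable whose value is the color placed on the condition `b`: it is `v_e` if `b`
is produced by the event `e` along an arc labeled `v`, and `v^b_⊥` if no event produces `b`. -/
noncomputable def condVar (O : HLNet K V B E) (b : B) : IVar V B E :=
  if h : ∃ ev : E × V, (b, ev.2) ∈ O.post ev.1 then IVar.event h.choose.1 h.choose.2
  else IVar.bot b

/-- The assignment `θ` satisfies the predicate of `⊥`. -/
def SatBot (O : HLNet K V B E) (θ : IVar V B E → K) : Prop :=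
  ∃ M ∈ O.init, ∀ b k, (b, k) ∈ M → θ (IVar.bot b) = k

/-- The assignment `θ` satisfies the local predicate of `e`. -/
def SatLoc (O : HLNet K V B E) (θ : IVar V B E → K) (e : E) : Prop :=
  O.guard e (fun v => θ (IVar.event e v)) ∧
    ∀ b v, (b, v) ∈ O.pre e → θ (IVar.event e v) = θ (O.condVar b)

/-- The assignment `θ` satisfies the predicate of `e`. -/
def SatPred (O : HLNet K V B E) (θ : IVar V B E → K) (e : E) : Prop :=
  O.SatBot θ ∧ ∀ e', O.Le (Sum.inr e') (Sum.inr e) → O.SatLoc θ e'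

/-- Symbolic configurations: sets of events that are free of structural conflict, free of color
conflict, and causally closed. They may be infinite. -/
structure IsConfiguration (O : HLNet K V B E) (C : Set E) : Prop where
  no_conflict : ∀ e ∈ C, ∀ e' ∈ C, ¬ O.Conflict (Sum.inr e) (Sum.inr e')
  no_color_conflict : ∃ θ : IVar V B E → K, ∀ e ∈ C, O.SatPred θ e
  closed : ∀ e ∈ C, ∀ e', O.Le (Sum.inr e') (Sum.inr e) → e' ∈ C

/-- Instantiations of a set `C` of events: all predicates of `C ∪ {⊥}` are satisfied. (They are
represented by total assignments; only the values of the indexed variables of `C ∪ {⊥}` matter.) -/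
def IsInstantiation (O : HLNet K V B E) (C : Set E) (θ : IVar V B E → K) : Prop :=
  O.SatBot θ ∧ ∀ e ∈ C, O.SatPred θ e

/-- The conditions occupied after any execution of `C`. -/
def cut (O : HLNet K V B E) (C : Set E) : Set B :=
  (O.initConds ∪ {b | ∃ e ∈ C, O.Flow (Sum.inr e) (Sum.inl b)}) \
    {b | ∃ e ∈ C, O.Flow (Sum.inl b) (Sum.inr e)}

/-- The instantiated cut, as a set of pairs of a condition and the color on it. -/
def instCutSet (O : HLNet K V B E) (C : Set E) (θ : IVar V B E → K) : Set (B × K) :=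
  {x | x.1 ∈ O.cut C ∧ θ (O.condVar x.1) = x.2}

open Classical in
/-- The instantiated cut as a multiset, i.e. as a marking of the occurrence net. It is meaningful
if the cut is finite, which is always the case for a finite `C` in an occurrence net. -/
noncomputable def instCut (O : HLNet K V B E) (C : Set E) (θ : IVar V B E → K) :
    Multiset (B × K) :=
  if h : (O.instCutSet C θ).Finite then h.toFinset.val else 0

end HLNet

/-- Symbolic branching processes of a high-level Petri net `N`. -/
structure BranchingProcess {K V P T : Type u} (N : HLNet K V P T) where
  /-- conditions -/
  B : Type u
  /-- events -/
  E : Type u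
  net : HLNet K V B E
  homB : B → P
  homE : E → T
  occurrence : net.IsOccurrenceNet
  satisfiable : ∀ e, ∃ θ : IVar V B E → K, net.SatPred θ e
  initial : net.IsInitialHom N homB homE
  inj : ∀ e e', net.pre e = net.pre e' → homE e = homE e' → e = e'

namespace BranchingProcess

variable {K V P T : Type u} {N : HLNet K V P T}

/-- `β` is a prefix of `β'`. -/
def IsPrefix (β β' : BranchingProcess N) : Prop :=
  ∃ (f : β.B → β'.B) (g : β.E → β'.E), Function.Injective f ∧ Function.Injective g ∧
    β.net.IsInitialHom β'.net f g ∧ β'.homB ∘ f = β.homB ∧ β'.homE ∘ g = β.homE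

/-- `β` is a symbolic unfolding: a branching process that is maximal for the prefix relation. -/
def IsUnfolding (β : BranchingProcess N) : Prop :=
  ∀ β' : BranchingProcess N, β.IsPrefix β' → β'.IsPrefix β

/-- The marking of `N` represented by an instantiated configuration. -/
noncomputable def marking (β : BranchingProcess N) (C : Set β.E) (θ : IVar V β.B β.E → K) :
    Multiset (P × K) :=
  (β.net.instCut C θ).map fun x => (β.homB x.1, x.2)

end BranchingProcess

/-! Both parts rest on one fact: an unfolding already contains every event that could be attached to
a cut of one of its configurations (`IsUnfolding.exists_event`). If such an event were missing,
adding it with fresh output conditions would give a larger branching process (`addEvent`).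
Maximality embeds the larger process back into the unfolding, so composing the two embeddings gives
an injective endomorphism of the unfolding that preserves labels. For infinite nets this is not yet
a contradiction. However, such an endomorphism permutes the events, because every node is periodic
(`surjective_of_endomorphism`): the initial conditions are finitely many, an event is determined by
its label and its finite preset, and an event has finitely many outputs. Hence the inclusion into
the larger process is onto on events, yet it misses the new one.

For part 2, a mode enabled at `M(C,θ)` selects tokens of the instantiated cut. Their conditions form
a possible preset, so the event exists; the converse holds because homomorphisms preserve
enabledness.

For part 1, firing an event outside `C` turns the marking of `C` into that of `insert e C`
(`marking_insert`). One inclusion follows firing sequences using part 2; the other removes causally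
maximal events and holds in any branching process. An enabled event already in `C` must have empty
preset. Equal presets and labels force equal events, so the unfolding cannot repeat it, and the
hypothesis on empty presets makes the repetition harmless. -/

/-- The multiset `r` is a matching. With `s` a preset and `t` an instantiated cut, it assigns to
every arc its own token of the required place and color. -/
theorem Multiset.exists_map_eq_of_map_le_map {α β γ : Type*} (f : α → γ) (g : β → γ)
    (s : Multiset α) (t : Multiset β) (h : s.map f ≤ t.map g) :
    ∃ r : Multiset (α × β), r.map Prod.fst = s ∧ r.map Prod.snd ≤ t ∧ ∀ x ∈ r, f x.1 = g x.2 := by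
  classical
  induction s using Multiset.induction_on generalizing t with
  | empty => exact ⟨0, by simp⟩
  | cons a s ih =>
    rw [Multiset.map_cons] at h
    have ha : f a ∈ t.map g := Multiset.mem_of_le h (Multiset.mem_cons_self _ _)
    obtain ⟨b, hb, hab⟩ := Multiset.mem_map.1 ha
    obtain ⟨t, rfl⟩ := Multiset.exists_cons_of_mem hb
    rw [Multiset.map_cons, hab, Multiset.cons_le_cons_iff] at h
    obtain ⟨r, hr, hrt, hrx⟩ := ih t h
    refine ⟨(a, b) ::ₘ r, by simp [hr], by simpa using hrt, ?_⟩
    intro x hx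
    rcases Multiset.mem_cons.1 hx with rfl | hx
    · exact hab.symm
    · exact hrx x hx

/-- By pigeonhole two iterates of `a` coincide, and injectivity cancels the smaller exponent. -/
theorem Set.Finite.mem_periodicPts {α : Type*} {f : α → α} (hf : Function.Injective f)
    {s : Set α} (hs : s.Finite) (hm : Set.MapsTo f s s) {a : α} (ha : a ∈ s) :
    a ∈ Function.periodicPts f := by
  have hmem : ∀ n : ℕ, f^[n] a ∈ s := fun n => hm.iterate n ha
  obtain ⟨i, -, j, -, hij, h⟩ :=
    Set.infinite_univ.exists_ne_map_eq_of_mapsTo (fun n _ => hmem n) hs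
  wlog hlt : i < j generalizing i j
  · exact this j i hij.symm h.symm (lt_of_le_of_ne (not_lt.1 hlt) hij.symm)
  refine ⟨j - i, Nat.sub_pos_of_lt hlt, ?_⟩
  apply hf.iterate i
  rw [← Function.iterate_add_apply, Nat.add_sub_cancel' hlt.le]
  exact h.symm

/-! ### Cuts and firing in occurrence nets -/

namespace HLNet

variable {K V B E : Type u} {O : HLNet K V B E}

theorem mem_map_fst_iff {α β : Type*} {M : Multiset (α × β)} {a : α} :
    a ∈ M.map Prod.fst ↔ ∃ b, (a, b) ∈ M := by simp

theorem mem_initConds_iff {M : Multiset (B × K)} (hM : M ∈ O.init) {b : B} :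
    b ∈ O.initConds ↔ ∃ k, (b, k) ∈ M := by
  refine ⟨?_, fun ⟨k, hk⟩ => ⟨M, hM, k, hk⟩⟩
  rintro ⟨M', hM', k, hk⟩
  rw [← mem_map_fst_iff, O.init_places M hM M' hM', mem_map_fst_iff]
  exact ⟨k, hk⟩

theorem finite_initConds (O : HLNet K V B E) : O.initConds.Finite := by
  classical
  obtain ⟨M, hM⟩ := O.init_nonempty
  refine (M.map Prod.fst).toFinset.finite_toSet.subset fun b hb => ?_
  simpa using (mem_initConds_iff hM).1 hb

theorem finite_produced (O : HLNet K V B E) (e : E) :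
    {b | O.Flow (Sum.inr e) (Sum.inl b)}.Finite := by
  classical
  refine ((O.post e).map Prod.fst).toFinset.finite_toSet.subset ?_
  rintro b ⟨v, hv⟩
  simp only [SetLike.mem_coe, Multiset.mem_toFinset]
  exact mem_map_fst_iff.2 ⟨v, hv⟩

theorem finite_cut (O : HLNet K V B E) {C : Set E} (hC : C.Finite) : (O.cut C).Finite := by
  refine Set.Finite.subset ?_ Set.sdiff_subset
  refine O.finite_initConds.union ((hC.biUnion fun e _ => O.finite_produced e).subset ?_)
  rintro b ⟨e, he, hb⟩
  exact Set.mem_biUnion he hb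

theorem le_event_cases {x : B ⊕ E} {e : E} (h : O.Le x (Sum.inr e)) :
    x = Sum.inr e ∨ ∃ b v, (b, v) ∈ O.pre e ∧ O.Le x (Sum.inl b) := by
  rcases Relation.ReflTransGen.cases_tail h with h | ⟨y, hxy, hy⟩
  · exact Or.inl h.symm
  · right
    cases y with
    | inl b => obtain ⟨v, hv⟩ := hy; exact ⟨b, v, hv, hxy⟩
    | inr _ => exact hy.elim

theorem event_le_cond {t : E} {b : B} (h : O.Le (Sum.inr t) (Sum.inl b)) :
    ∃ e, O.Flow (Sum.inr e) (Sum.inl b) ∧ O.Le (Sum.inr t) (Sum.inr e) := by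
  rcases Relation.ReflTransGen.cases_tail h with h | ⟨y, hxy, hy⟩
  · cases h
  · cases y with
    | inl _ => exact hy.elim
    | inr e => exact ⟨e, hy, hxy⟩

theorem le_of_post_pre {e e' : E} {b : B} (h : O.Flow (Sum.inr e) (Sum.inl b))
    (h' : O.Flow (Sum.inl b) (Sum.inr e')) : O.Le (Sum.inr e) (Sum.inr e') :=
  (Relation.ReflTransGen.single h).tail h'

namespace IsOccurrenceNet

variable (hO : O.IsOccurrenceNet)
include hO

theorem not_flow_of_initial {b : B} (hb : b ∈ O.initConds) (e : E) :
    ¬ O.Flow (Sum.inr e) (Sum.inl b) := by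
  classical
  rcases hO.origin b with ⟨h, -⟩ | ⟨h, -⟩
  · exact h.2 e
  · obtain ⟨M, hM, k, hk⟩ := hb
    have h0 := h.1 M hM
    rw [Multiset.count_eq_zero] at h0
    exact absurd (mem_map_fst_iff.2 ⟨k, hk⟩) h0

theorem initial_or_produced (b : B) : b ∈ O.initConds ∨ ∃ e v, (b, v) ∈ O.post e := by
  classical
  rcases hO.origin b with ⟨h, -⟩ | ⟨h, -⟩
  · obtain ⟨M, hM⟩ := O.init_nonempty
    have h1 := h.1 M hM
    have : b ∈ M.map Prod.fst := Multiset.count_pos.1 (by convert Nat.one_pos)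
    exact Or.inl ((mem_initConds_iff hM).2 (mem_map_fst_iff.1 this))
  · obtain ⟨ev, h, -⟩ := h.2
    exact Or.inr ⟨_, _, h⟩

theorem unique_producer {b : B} {e e' : E} {v v' : V} (h : (b, v) ∈ O.post e)
    (h' : (b, v') ∈ O.post e') : e = e' ∧ v = v' := by
  classical
  rcases hO.origin b with ⟨h0, -⟩ | ⟨h0, -⟩
  · exact absurd ⟨v, h⟩ (h0.2 e)
  · have := h0.2.unique (y₁ := (e, v)) (y₂ := (e', v')) h h'
    simpa using this

theorem condVar_of_mem_post {b : B} {e : E} {v : V} (h : (b, v) ∈ O.post e) :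
    O.condVar b = IVar.event e v := by
  have hex : ∃ ev : E × V, (b, ev.2) ∈ O.post ev.1 := ⟨(e, v), h⟩
  rw [condVar, dif_pos hex]
  obtain ⟨h1, h2⟩ := hO.unique_producer hex.choose_spec h
  rw [h1, h2]

theorem condVar_of_initial {b : B} (hb : b ∈ O.initConds) : O.condVar b = IVar.bot b := by
  rw [condVar, dif_neg]
  rintro ⟨ev, h⟩
  exact hO.not_flow_of_initial hb ev.1 ⟨ev.2, h⟩

theorem nodup_map_fst_of_init {M : Multiset (B × K)} (hM : M ∈ O.init) :
    (M.map Prod.fst).Nodup := by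
  classical
  rw [Multiset.nodup_iff_count_le_one]
  intro b
  rcases hO.origin b with ⟨h, -⟩ | ⟨h, -⟩
  · have := h.1 M hM
    convert this.le
  · have := h.1 M hM
    exact le_trans (by convert this.le) zero_le_one

theorem mem_of_mem_cut {C : Set E} {b : B} (hb : b ∈ O.cut C) {e : E}
    (h : O.Flow (Sum.inr e) (Sum.inl b)) : e ∈ C := by
  rcases hb.1 with hi | ⟨e', he', v', hv'⟩
  · exact absurd h (hO.not_flow_of_initial hi e)
  · obtain ⟨v, hv⟩ := h
    rwa [(hO.unique_producer hv hv').1]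

end IsOccurrenceNet

theorem nodup_of_nodup_map_fst {α β : Type*} {M : Multiset (α × β)} (h : (M.map Prod.fst).Nodup) :
    M.Nodup := Multiset.Nodup.of_map _ h

theorem snd_eq_of_nodup_map_fst {α β : Type*} {M : Multiset (α × β)}
    (h : (M.map Prod.fst).Nodup) {a : α} {b b' : β} (hb : (a, b) ∈ M) (hb' : (a, b') ∈ M) :
    b = b' :=
  congrArg Prod.snd (Multiset.inj_on_of_nodup_map h _ hb _ hb' rfl)

section Cut

variable {C : Set E} {θ : IVar V B E → K}

theorem finite_instCutSet (h : (O.cut C).Finite) (θ : IVar V B E → K) :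
    (O.instCutSet C θ).Finite := by
  refine (h.image fun b => (b, θ (O.condVar b))).subset ?_
  rintro ⟨b, k⟩ ⟨hb, hk⟩
  exact ⟨b, hb, by simpa using hk⟩

theorem mem_instCut (h : (O.cut C).Finite) {b : B} {k : K} :
    (b, k) ∈ O.instCut C θ ↔ b ∈ O.cut C ∧ θ (O.condVar b) = k := by
  rw [instCut, dif_pos (finite_instCutSet h θ)]
  simp [instCutSet]

theorem nodup_instCut (O : HLNet K V B E) (C : Set E) (θ : IVar V B E → K) :
    (O.instCut C θ).Nodup := by
  unfold instCut
  split_ifs with h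
  · exact h.toFinset.nodup
  · exact Multiset.nodup_zero

theorem nodup_map_fst_instCut (h : (O.cut C).Finite) :
    ((O.instCut C θ).map Prod.fst).Nodup := by
  refine (nodup_instCut O C θ).map_on ?_
  rintro ⟨b, k⟩ hx ⟨b', k'⟩ hy (rfl : b = b')
  rw [mem_instCut h] at hx hy
  rw [← hx.2, ← hy.2]

theorem instCut_congr {θ' : IVar V B E → K}
    (h : ∀ b ∈ O.cut C, θ (O.condVar b) = θ' (O.condVar b)) :
    O.instCut C θ = O.instCut C θ' := by
  have : O.instCutSet C θ = O.instCutSet C θ' := by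
    ext ⟨b, k⟩
    constructor
    · rintro ⟨hb, hk⟩
      exact ⟨hb, (h b hb).symm.trans hk⟩
    · rintro ⟨hb, hk⟩
      exact ⟨hb, (h b hb).trans hk⟩
  classical
  have key : ∀ S S' : Set (B × K), S = S' →
      (if h : S.Finite then h.toFinset.val else 0) =
        if h : S'.Finite then h.toFinset.val else 0 := by
    rintro S _ rfl
    rfl
  exact key _ _ this

theorem instCut_empty (hO : O.IsOccurrenceNet) {M : Multiset (B × K)} (hM : M ∈ O.init)
    (hθ : ∀ b k, (b, k) ∈ M → θ (IVar.bot b) = k) : O.instCut ∅ θ = M := by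
  have hn := hO.nodup_map_fst_of_init hM
  refine (Multiset.Nodup.ext (nodup_instCut _ _ _) (nodup_of_nodup_map_fst hn)).2 ?_
  rintro ⟨b, k⟩
  have hcut : b ∈ O.cut ∅ ↔ b ∈ O.initConds := by simp [cut]
  rw [mem_instCut (O.finite_cut Set.finite_empty), hcut]
  constructor
  · rintro ⟨hb, rfl⟩
    rw [hO.condVar_of_initial hb]
    obtain ⟨k, hk⟩ := (mem_initConds_iff hM).1 hb
    rwa [hθ b k hk]
  · intro h
    have hb : b ∈ O.initConds := ⟨M, hM, k, h⟩
    exact ⟨hb, by rw [hO.condVar_of_initial hb, hθ b k h]⟩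

theorem exists_assignment_of_init [Nonempty K] (hO : O.IsOccurrenceNet) {M : Multiset (B × K)}
    (hM : M ∈ O.init) :
    ∃ θ : IVar V B E → K, ∀ b k, (b, k) ∈ M → θ (IVar.bot b) = k := by
  classical
  let c : B → K := fun b => if h : ∃ k, (b, k) ∈ M then h.choose else Classical.arbitrary K
  refine ⟨fun x => match x with
    | .event _ _ => Classical.arbitrary K
    | .bot b => c b, fun b k hk => ?_⟩
  have hex : ∃ k, (b, k) ∈ M := ⟨k, hk⟩
  simp only [c, dif_pos hex]
  exact snd_eq_of_nodup_map_fst (hO.nodup_map_fst_of_init hM) hex.choose_spec hk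

/-- An event whose preset lies in a cut has all its proper causal predecessors below that cut. -/
theorem IsOccurrenceNet.eq_or_mem_of_le (hO : O.IsOccurrenceNet)
    (hcl : ∀ e ∈ C, ∀ e', O.Le (Sum.inr e') (Sum.inr e) → e' ∈ C) {e : E}
    (hpre : ∀ b v, (b, v) ∈ O.pre e → b ∈ O.cut C) {t : E} (h : O.Le (Sum.inr t) (Sum.inr e)) :
    t = e ∨ t ∈ C := by
  rcases le_event_cases h with h | ⟨b, v, hb, h⟩
  · exact Or.inl (Sum.inr.inj h)
  · obtain ⟨e', he', hle⟩ := event_le_cond h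
    exact Or.inr (hcl e' (hO.mem_of_mem_cut (hpre b v hb) he') t hle)

theorem mem_cut_of_enabled (hf : (O.cut C).Finite) {e : E} {σ : V → K}
    (h : O.preMode e σ ≤ O.instCut C θ) {b : B} {v : V} (hb : (b, v) ∈ O.pre e) :
    b ∈ O.cut C ∧ θ (O.condVar b) = σ v := by
  rw [← mem_instCut hf]
  exact Multiset.mem_of_le h (Multiset.mem_map_of_mem (fun x : B × V => (x.1, σ x.2)) hb)

theorem preMode_le_instCut (hO : O.IsOccurrenceNet) (hf : (O.cut C).Finite) {e : E} {σ : V → K}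
    (h : ∀ b v, (b, v) ∈ O.pre e → b ∈ O.cut C ∧ θ (O.condVar b) = σ v) :
    O.preMode e σ ≤ O.instCut C θ := by
  -- Arcs have weight at most one, so the multiset inequality reduces to membership.
  have hn : (O.preMode e σ).Nodup := by
    refine nodup_of_nodup_map_fst ?_
    simpa [preMode] using (hO.ordinary e).1
  rw [Multiset.le_iff_subset hn]
  rintro ⟨b, k⟩ hk
  obtain ⟨⟨b', v⟩, hbv, heq⟩ := Multiset.mem_map.1 hk
  obtain ⟨rfl, rfl⟩ := Prod.mk.inj heq
  exact (mem_instCut hf).2 (h _ _ hbv)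

/-- Both sides are free of repetitions, so only membership is compared. Passing to `insert e C`
removes the inputs of `e` from the cut and adds its outputs. No event of `C` consumes these outputs,
since `C` is causally closed and does not contain `e`. -/
theorem instCut_insert (hO : O.IsOccurrenceNet) (hf : (O.cut C).Finite)
    (hcl : ∀ e ∈ C, ∀ e', O.Le (Sum.inr e') (Sum.inr e) → e' ∈ C) {e : E} (he : e ∉ C)
    (hpre : O.preMode e (fun v => θ (IVar.event e v)) ≤ O.instCut C θ) :
    (O.cut (insert e C)).Finite ∧
    O.instCut (insert e C) θ = O.fire (O.instCut C θ) e fun v => θ (IVar.event e v) := by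
  classical
  set σ : V → K := fun v => θ (IVar.event e v) with hσ
  have hcut : ∀ b, b ∈ O.cut (insert e C) ↔
      (b ∈ O.cut C ∧ ¬ O.Flow (Sum.inl b) (Sum.inr e)) ∨ O.Flow (Sum.inr e) (Sum.inl b) := by
    intro b
    constructor
    · rintro ⟨h1, h2⟩
      by_cases hb : O.Flow (Sum.inr e) (Sum.inl b)
      · exact Or.inr hb
      refine Or.inl ⟨⟨h1.imp_right ?_, fun ⟨e', he', h⟩ => h2 ⟨e', Or.inr he', h⟩⟩,
        fun h => h2 ⟨e, Or.inl rfl, h⟩⟩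
      rintro ⟨e', rfl | he', h⟩
      · exact absurd h hb
      · exact ⟨e', he', h⟩
    · rintro (⟨⟨h1, h2⟩, h3⟩ | h)
      · refine ⟨h1.imp_right fun ⟨e', he', h⟩ => ⟨e', Or.inr he', h⟩, ?_⟩
        rintro ⟨e', rfl | he', h⟩
        · exact h3 h
        · exact h2 ⟨e', he', h⟩
      · refine ⟨Or.inr ⟨e, Or.inl rfl, h⟩, ?_⟩
        rintro ⟨e', rfl | he', h'⟩
        · exact hO.irrefl _ ((Relation.TransGen.single h).tail h')
        · exact he (hcl e' he' e (le_of_post_pre h h'))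
  have hf' : (O.cut (insert e C)).Finite := by
    refine (hf.union (O.finite_produced e)).subset fun b hb => ?_
    exact ((hcut b).1 hb).imp (fun h => h.1) id
  refine ⟨hf', ?_⟩
  have hn1 := nodup_instCut O C θ
  have hn2 : (O.postMode e σ).Nodup := by
    refine nodup_of_nodup_map_fst ?_
    simpa [postMode] using (hO.ordinary e).2
  have hpost : ∀ b k, (b, k) ∈ O.postMode e σ ↔
      O.Flow (Sum.inr e) (Sum.inl b) ∧ θ (O.condVar b) = k := by
    intro b k
    constructor
    · intro hk
      obtain ⟨⟨b', v⟩, hbv, heq⟩ := Multiset.mem_map.1 hk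
      obtain ⟨rfl, rfl⟩ := Prod.mk.inj heq
      exact ⟨⟨v, hbv⟩, by rw [hO.condVar_of_mem_post hbv]⟩
    · rintro ⟨⟨v, hv⟩, rfl⟩
      rw [hO.condVar_of_mem_post hv]
      exact Multiset.mem_map_of_mem (fun x : B × V => (x.1, σ x.2)) hv
  have hpre' : ∀ b k, (b, k) ∈ O.instCut C θ →
      ((b, k) ∈ O.preMode e σ ↔ O.Flow (Sum.inl b) (Sum.inr e)) := by
    intro b k hbk
    constructor
    · intro hk
      obtain ⟨⟨b', v⟩, hbv, heq⟩ := Multiset.mem_map.1 hk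
      obtain ⟨rfl, rfl⟩ := Prod.mk.inj heq
      exact ⟨v, hbv⟩
    · rintro ⟨v, hv⟩
      rw [← ((mem_instCut hf).1 hbk).2, (mem_cut_of_enabled hf hpre hv).2]
      exact Multiset.mem_map_of_mem (fun x : B × V => (x.1, σ x.2)) hv
  -- An output of `e` is not in the old cut: producers of conditions in the cut lie in `C`.
  have hn : (O.fire (O.instCut C θ) e σ).Nodup := by
    refine (Multiset.Nodup.add_iff (Multiset.nodup_of_le (Multiset.sub_le_self _ _) hn1)
      hn2).2 ?_
    rw [Multiset.disjoint_left]
    rintro ⟨b, k⟩ h1 h2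
    have h1 := ((mem_instCut hf).1 (Multiset.mem_of_le (Multiset.sub_le_self _ _) h1)).1
    exact he (hO.mem_of_mem_cut h1 ((hpost b k).1 h2).1)
  refine (Multiset.Nodup.ext (nodup_instCut _ _ _) hn).2 ?_
  rintro ⟨b, k⟩
  have hsub : (b, k) ∈ O.instCut C θ - O.preMode e σ ↔
      (b ∈ O.cut C ∧ θ (O.condVar b) = k) ∧ ¬ O.Flow (Sum.inl b) (Sum.inr e) := by
    rw [Multiset.mem_sub_of_nodup hn1, ← mem_instCut hf]
    exact and_congr_right fun h => not_congr (hpre' b k h)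
  have hfire : (b, k) ∈ O.fire (O.instCut C θ) e σ ↔
      (b, k) ∈ O.instCut C θ - O.preMode e σ ∨ (b, k) ∈ O.postMode e σ := by
    unfold fire
    convert Multiset.mem_add
  rw [mem_instCut hf', hcut, hfire, hsub, hpost]
  tauto

end Cut

theorem IsHom.preMode_eq {P T : Type u} {N : HLNet K V P T} {f : B → P} {g : E → T}
    (h : O.IsHom N f g) (e : E) (σ : V → K) :
    N.preMode (g e) σ = (O.preMode e σ).map fun x => (f x.1, x.2) := by
  simp [preMode, h.pre_eq]

theorem IsHom.postMode_eq {P T : Type u} {N : HLNet K V P T} {f : B → P} {g : E → T}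
    (h : O.IsHom N f g) (e : E) (σ : V → K) :
    N.postMode (g e) σ = (O.postMode e σ).map fun x => (f x.1, x.2) := by
  simp [postMode, h.post_eq]

/-- Homomorphisms preserve enabledness. -/
theorem IsHom.enabled {P T : Type u} {N : HLNet K V P T} {f : B → P} {g : E → T}
    (h : O.IsHom N f g) {M : Multiset (B × K)} {e : E} {σ : V → K} (he : O.Enabled M e σ) :
    N.Enabled (M.map fun x => (f x.1, x.2)) (g e) σ := by
  refine ⟨?_, ?_⟩
  · have := he.1
    rwa [IsMode, h.guard_eq] at this
  · rw [h.preMode_eq]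
    exact Multiset.map_le_map he.2

/-- Homomorphisms are compatible with firing. -/
theorem IsHom.fire_eq {P T : Type u} {N : HLNet K V P T} {f : B → P} {g : E → T}
    (h : O.IsHom N f g) {M : Multiset (B × K)} {e : E} {σ : V → K} (he : O.preMode e σ ≤ M) :
    (O.fire M e σ).map (fun x => (f x.1, x.2)) =
      N.fire (M.map fun x => (f x.1, x.2)) (g e) σ := by
  classical
  -- Splitting off the preset makes the truncated subtraction exact, so it commutes with the map.
  obtain ⟨R, rfl⟩ := Multiset.le_iff_exists_add.1 he
  simp [fire, h.preMode_eq, h.postMode_eq, Multiset.map_add]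

end HLNet

/-! ### Injective endomorphisms of branching processes -/

namespace BranchingProcess

variable {K V P T : Type u} {N : HLNet K V P T} {β : BranchingProcess N}

open Function in
theorem exists_common_period {α γ : Type*} {f : α → α} (s : Multiset (α × γ))
    (h : ∀ x ∈ s, x.1 ∈ periodicPts f) : ∃ n > 0, ∀ x ∈ s, IsPeriodicPt f n x.1 := by
  induction s using Multiset.induction_on with
  | empty => exact ⟨1, Nat.one_pos, by simp⟩
  | cons a s ih =>
    obtain ⟨n, hn, hs⟩ := ih fun x hx => h x (Multiset.mem_cons_of_mem hx)
    obtain ⟨m, hm, ha⟩ := h a (Multiset.mem_cons_self _ _)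
    refine ⟨n * m, Nat.mul_pos hn hm, fun x hx => ?_⟩
    rcases Multiset.mem_cons.1 hx with rfl | hx
    · exact ha.const_mul n
    · exact (hs x hx).mul_const m

/-- Injective endomorphisms of a branching process over the net permute its events. All orbits are
finite, by induction along causality. -/
theorem surjective_of_endomorphism {f : β.B → β.B} {g : β.E → β.E} (hf : Function.Injective f)
    (hinit : Set.MapsTo f β.net.initConds β.net.initConds) (hhom : β.net.IsHom β.net f g)
    (hg : β.homE ∘ g = β.homE) : Function.Surjective g := by
  have hpre : ∀ n e, β.net.pre (g^[n] e) = (β.net.pre e).map fun x => (f^[n] x.1, x.2) := by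
    intro n
    induction n with
    | zero => simp
    | succ n ih =>
      intro e
      rw [Function.iterate_succ_apply', hhom.pre_eq, ih, Multiset.map_map]
      simp only [Function.comp_def, Function.iterate_succ_apply']
  have hpost : ∀ n e, β.net.post (g^[n] e) = (β.net.post e).map fun x => (f^[n] x.1, x.2) := by
    intro n
    induction n with
    | zero => simp
    | succ n ih =>
      intro e
      rw [Function.iterate_succ_apply', hhom.post_eq, ih, Multiset.map_map]
      simp only [Function.comp_def, Function.iterate_succ_apply']
  have hE : ∀ n e, β.homE (g^[n] e) = β.homE e := by
    intro n
    induction n with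
    | zero => simp
    | succ n ih =>
      intro e
      rw [Function.iterate_succ_apply', ← ih e]
      exact congrFun hg _
  have key : ∀ x : β.B ⊕ β.E, Sum.elim (· ∈ Function.periodicPts f)
      (· ∈ Function.periodicPts g) x := by
    intro x
    induction x using β.occurrence.wellFounded.induction with
    | _ x ih =>
      cases x with
      | inl b =>
        rcases β.occurrence.initial_or_produced b with hb | ⟨e, v, hbe⟩
        · exact Set.Finite.mem_periodicPts hf β.net.finite_initConds hinit hb
        · obtain ⟨n, hn, he⟩ : e ∈ Function.periodicPts g :=
            ih (Sum.inr e) (Relation.TransGen.single ⟨v, hbe⟩)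
          -- Since `g^[n]` fixes the producer `e`, `f^[n]` maps the finite set of outputs of `e` to
          -- itself.
          obtain ⟨m, hm, hb⟩ := Set.Finite.mem_periodicPts (hf.iterate n)
            (β.net.finite_produced e) (a := b) (by
              rintro b ⟨v, hv⟩
              refine ⟨v, ?_⟩
              have := Multiset.mem_map_of_mem (fun x : β.B × V => (f^[n] x.1, x.2)) hv
              rwa [← hpost, he.eq] at this) ⟨v, hbe⟩
          refine ⟨n * m, Nat.mul_pos hn hm, ?_⟩
          rw [Function.IsPeriodicPt, Function.iterate_mul]
          exact hb
      | inr e =>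
        obtain ⟨n, hn, h⟩ := exists_common_period (f := f) (β.net.pre e) fun x hx =>
          ih (Sum.inl x.1) (Relation.TransGen.single ⟨x.2, hx⟩)
        -- With `n` a common period of the preset, `g^[n] e` and `e` have equal presets and labels,
        -- hence coincide.
        refine ⟨n, hn, β.inj _ _ ?_ (hE n e)⟩
        rw [hpre]
        conv_rhs => rw [← Multiset.map_id (β.net.pre e)]
        refine Multiset.map_congr rfl fun x hx => ?_
        rw [(h x hx).eq]
        rfl
  intro e
  obtain ⟨n, hn, he⟩ : e ∈ Function.periodicPts g := key (Sum.inr e)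
  refine ⟨g^[n - 1] e, ?_⟩
  rw [← Function.iterate_succ_apply' g, Nat.succ_eq_add_one, Nat.sub_add_cancel hn]
  exact he

end BranchingProcess

/-! ### Extending an occurrence net by one event -/

namespace HLNet

variable {K V B E ι : Type u} [Fintype ι]

/-- The net `O` with one more event, which has preset `X`, guard `G`, and one new condition in its
postset for each element `i` of `ι`, along an arc labeled `l i`. -/
def addEvent (O : HLNet K V B E) (X : Multiset (B × V)) (G : (V → K) → Prop) (l : ι → V)
    (hG : ∀ σ σ' : V → K, (∀ b v, (b, v) ∈ X → σ v = σ' v) → (∀ i, σ (l i) = σ' (l i)) →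
      (G σ ↔ G σ')) : HLNet K V (B ⊕ ι) (Option E) where
  pre
    | some e => (O.pre e).map fun x => (Sum.inl x.1, x.2)
    | none => X.map fun x => (Sum.inl x.1, x.2)
  post
    | some e => (O.post e).map fun x => (Sum.inl x.1, x.2)
    | none => Finset.univ.val.map fun i => (Sum.inr i, l i)
  guard
    | some e => O.guard e
    | none => G
  guard_congr := by
    rintro (_ | e) σ σ' h
    · refine hG σ σ' (fun b v hb => h (Sum.inl b) v (Or.inl ?_)) fun i =>
        h (Sum.inr i) (l i) (Or.inr ?_)
      · exact Multiset.mem_map_of_mem (fun x : B × V => ((Sum.inl x.1 : B ⊕ ι), x.2)) hb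
      · exact Multiset.mem_map_of_mem (fun i : ι => ((Sum.inr i : B ⊕ ι), l i))
          (Finset.mem_univ_val i)
    · refine O.guard_congr e σ σ' fun b v hb => h (Sum.inl b) v (hb.imp ?_ ?_) <;>
      exact fun hb => Multiset.mem_map_of_mem (fun x : B × V => ((Sum.inl x.1 : B ⊕ ι), x.2)) hb
  init := (fun M => M.map fun x => (Sum.inl x.1, x.2)) '' O.init
  init_nonempty := O.init_nonempty.image _
  init_places := by
    rintro _ ⟨M, hM, rfl⟩ _ ⟨M', hM', rfl⟩
    have := congrArg (Multiset.map (Sum.inl : B → B ⊕ ι)) (O.init_places M hM M' hM')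
    simpa [Multiset.map_map, Function.comp_def] using this

namespace addEvent

variable {O : HLNet K V B E} {X : Multiset (B × V)} {G : (V → K) → Prop} {l : ι → V}
  {hG : ∀ σ σ' : V → K, (∀ b v, (b, v) ∈ X → σ v = σ' v) → (∀ i, σ (l i) = σ' (l i)) →
      (G σ ↔ G σ')}

omit [Fintype ι] in
theorem inl_mem_map {s : Multiset (B × V)} {b : B} {v : V} :
    ((Sum.inl b : B ⊕ ι), v) ∈ s.map (fun x => ((Sum.inl x.1 : B ⊕ ι), x.2)) ↔ (b, v) ∈ s := by
  simp

omit [Fintype ι] in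
theorem inr_notMem_map {α : Type*} {s : Multiset (B × α)} {i : ι} {v : α} :
    ((Sum.inr i : B ⊕ ι), v) ∉ s.map (fun x => ((Sum.inl x.1 : B ⊕ ι), x.2)) := by
  simp

/-- The predecessors of a node of the given net. -/
theorem flow_old {x : (B ⊕ ι) ⊕ Option E} {y : B ⊕ E}
    (h : (O.addEvent X G l hG).Flow x (Sum.map Sum.inl some y)) :
    ∃ x₀, x = Sum.map Sum.inl some x₀ ∧ O.Flow x₀ y := by
  rcases x with (b | i) | (_ | e) <;> rcases y with b' | e'
  · exact h.elim
  · obtain ⟨v, hv⟩ := h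
    exact ⟨Sum.inl b, rfl, v, inl_mem_map.1 hv⟩
  · exact h.elim
  · obtain ⟨v, hv⟩ := h
    exact absurd hv inr_notMem_map
  · obtain ⟨v, hv⟩ := h
    simp [addEvent] at hv
  · exact h.elim
  · obtain ⟨v, hv⟩ := h
    exact ⟨Sum.inr e, rfl, v, inl_mem_map.1 hv⟩
  · exact h.elim

theorem flow_none {x : (B ⊕ ι) ⊕ Option E}
    (h : (O.addEvent X G l hG).Flow x (Sum.inr none)) :
    ∃ b v, (b, v) ∈ X ∧ x = Sum.inl (Sum.inl b) := by
  rcases x with (b | i) | e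
  · obtain ⟨v, hv⟩ := h
    exact ⟨b, v, inl_mem_map.1 hv, rfl⟩
  · obtain ⟨v, hv⟩ := h
    exact absurd hv inr_notMem_map
  · exact h.elim

theorem flow_new {x : (B ⊕ ι) ⊕ Option E} {i : ι}
    (h : (O.addEvent X G l hG).Flow x (Sum.inl (Sum.inr i))) : x = Sum.inr none := by
  rcases x with b | (_ | e)
  · exact h.elim
  · rfl
  · obtain ⟨v, hv⟩ := h
    exact absurd hv inr_notMem_map

/-- No arc leads from a new node to an old one, so the old nodes are causally closed. Consequently
the extension does not change the causes of old events. -/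
theorem le_old {x : (B ⊕ ι) ⊕ Option E} {y : B ⊕ E}
    (h : (O.addEvent X G l hG).Le x (Sum.map Sum.inl some y)) :
    ∃ x₀, x = Sum.map Sum.inl some x₀ ∧ O.Le x₀ y := by
  induction h using Relation.ReflTransGen.head_induction_on with
  | refl => exact ⟨y, rfl, .refl⟩
  | head h _ ih =>
    obtain ⟨z, rfl, hz⟩ := ih
    obtain ⟨x, rfl, hx⟩ := flow_old h
    exact ⟨x, rfl, hz.head hx⟩

theorem event_le_old {e : Option E} {e' : E}
    (h : (O.addEvent X G l hG).Le (Sum.inr e) (Sum.inr (some e'))) :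
    ∃ e₀, e = some e₀ ∧ O.Le (Sum.inr e₀) (Sum.inr e') := by
  obtain ⟨x, hx, hle⟩ := le_old (y := Sum.inr e') h
  rcases x with b | e₀
  · cases hx
  · exact ⟨e₀, Sum.inr.inj hx, hle⟩

theorem wellFounded_flow (h : WellFounded O.Flow) : WellFounded (O.addEvent X G l hG).Flow := by
  have hold : ∀ y, Acc (O.addEvent X G l hG).Flow (Sum.map Sum.inl some y) := by
    intro y
    induction y using h.induction with
    | _ y ih =>
      refine Acc.intro _ fun x hx => ?_
      obtain ⟨x₀, rfl, hx₀⟩ := flow_old hx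
      exact ih x₀ hx₀
  have hnone : Acc (O.addEvent X G l hG).Flow (Sum.inr none) := by
    refine Acc.intro _ fun x hx => ?_
    obtain ⟨b, v, -, rfl⟩ := flow_none hx
    exact hold (Sum.inl b)
  refine ⟨?_⟩
  rintro ((b | i) | (_ | e))
  · exact hold (Sum.inl b)
  · refine Acc.intro _ fun x hx => ?_
    rw [flow_new hx]
    exact hnone
  · exact hnone
  · exact hold (Sum.inr e)

/-- Conditions of `X` lie in the cut, so their producers lie in `C`, which is causally closed. -/
theorem event_le_none (hO : O.IsOccurrenceNet) {C : Set E}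
    (hcl : ∀ e ∈ C, ∀ e', O.Le (Sum.inr e') (Sum.inr e) → e' ∈ C)
    (hX : ∀ b v, (b, v) ∈ X → b ∈ O.cut C) {e : Option E}
    (h : (O.addEvent X G l hG).Le (Sum.inr e) (Sum.inr none)) :
    e = none ∨ ∃ e₀ ∈ C, e = some e₀ := by
  rcases Relation.ReflTransGen.cases_tail h with h | ⟨y, hxy, hy⟩
  · exact Or.inl (Sum.inr.inj h).symm
  · obtain ⟨b, v, hb, rfl⟩ := flow_none hy
    obtain ⟨x, hx, hle⟩ := le_old (y := Sum.inl b) hxy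
    rcases x with b' | e₀
    · cases hx
    · obtain ⟨e', he', hle⟩ := event_le_cond hle
      exact Or.inr ⟨e₀, hcl e' (hO.mem_of_mem_cut (hX b v hb) he') _ hle, Sum.inr.inj hx⟩

/-- The only delicate point is that the new event is not in conflict with itself. Its proper causes
lie in the conflict-free set `C`, and its inputs lie in the cut, so no event of `C` competes for
them. -/
theorem isOccurrenceNet (hO : O.IsOccurrenceNet) {C : Set E}
    (hC : O.IsConfiguration C) (hX : ∀ b v, (b, v) ∈ X → b ∈ O.cut C)
    (hXn : (X.map Prod.fst).Nodup) : (O.addEvent X G l hG).IsOccurrenceNet := by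
  classical
  have hwf : WellFounded (O.addEvent X G l hG).Lt :=
    (wellFounded_flow ((Subrelation.wf fun h => Relation.TransGen.single h) hO.wellFounded)).transGen
  have hinl : Function.Injective (Sum.inl : B → B ⊕ ι) := Sum.inl_injective
  refine ⟨?_, ?_, fun x => hwf.irrefl.irrefl x, hwf, ?_⟩
  · have hmap : ∀ s : Multiset (B × V), (s.map Prod.fst).Nodup →
        ((s.map fun x => ((Sum.inl x.1 : B ⊕ ι), x.2)).map Prod.fst).Nodup := by
      intro s hs
      have := hs.map hinl
      simpa [Multiset.map_map, Function.comp_def] using this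
    rintro (_ | e)
    · refine ⟨hmap X hXn, ?_⟩
      have := (Finset.univ : Finset ι).nodup.map (Sum.inr_injective (α := B))
      simpa [addEvent, Multiset.map_map] using this
    · exact ⟨hmap _ (hO.ordinary e).1, hmap _ (hO.ordinary e).2⟩
  · rintro (_ | e) ⟨p, t, t', hne, hp, hp', ht, ht'⟩
    · have hcase : ∀ {s s' : Option E}, s ≠ s' →
          (O.addEvent X G l hG).Flow (Sum.inl p) (Sum.inr s) →
          (O.addEvent X G l hG).Flow (Sum.inl p) (Sum.inr s') →
          s = none → (∃ e₀ ∈ C, s' = some e₀) → False := by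
        rintro s s' - h h' rfl ⟨e₀, he₀, rfl⟩
        obtain ⟨b, v, hb, hpb⟩ := flow_none h
        obtain ⟨x, hx, hfl⟩ := flow_old (y := Sum.inr e₀) h'
        rw [hpb] at hx
        rcases x with b' | e'
        · obtain rfl : b = b' := by simpa using hx
          exact (hX b v hb).2 ⟨e₀, he₀, hfl⟩
        · cases hx
      rcases event_le_none hO hC.closed hX ht with h | h <;>
        rcases event_le_none hO hC.closed hX ht' with h' | h'
      · exact hne (h.trans h'.symm)
      · exact hcase hne hp hp' h h'
      · exact hcase hne.symm hp' hp h' h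
      · obtain ⟨e, he, rfl⟩ := h
        obtain ⟨e', he', rfl⟩ := h'
        obtain ⟨x, hx, hfl⟩ := flow_old (y := Sum.inr e) hp
        obtain ⟨x', hx', hfl'⟩ := flow_old (y := Sum.inr e') hp'
        rcases x with b | _ <;> rcases x' with b' | _
        · obtain rfl := Sum.inl.inj hx
          obtain rfl : b = b' := by simpa using hx'
          exact hC.no_conflict e he e' he' ⟨b, e, e', fun h => hne (congrArg some h), hfl, hfl',
            .refl, .refl⟩
        · cases hx'
        · cases hx
        · cases hx
    · obtain ⟨t, rfl, hle⟩ := event_le_old ht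
      obtain ⟨t', rfl, hle'⟩ := event_le_old ht'
      obtain ⟨x, hx, hfl⟩ := flow_old (y := Sum.inr t) hp
      obtain ⟨x', hx', hfl'⟩ := flow_old (y := Sum.inr t') hp'
      rcases x with b | _ <;> rcases x' with b' | _
      · obtain rfl := Sum.inl.inj hx
        obtain rfl : b = b' := by simpa using hx'
        exact hO.no_self_conflict e ⟨b, t, t', fun h => hne (congrArg some h), hfl, hfl',
          hle, hle'⟩
      · cases hx'
      · cases hx
      · cases hx
  · have hfst : ∀ M : Multiset (B × K), (M.map fun x => ((Sum.inl x.1 : B ⊕ ι), x.2)).map Prod.fst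
        = (M.map Prod.fst).map Sum.inl := by
      intro M
      simp [Multiset.map_map]
    rintro (b | i)
    · have hcount : ∀ n : ℕ,
          (∀ M ∈ (O.addEvent X G l hG).init, (M.map Prod.fst).count (Sum.inl b) = n) ↔
          ∀ M ∈ O.init, (M.map Prod.fst).count b = n := by
        intro n
        constructor
        · intro h M hM
          have := h _ ⟨M, hM, rfl⟩
          dsimp only at this
          rwa [hfst, Multiset.count_map_eq_count' _ _ hinl] at this
        · rintro h _ ⟨M, hM, rfl⟩
          dsimp only
          rw [hfst, Multiset.count_map_eq_count' _ _ hinl]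
          exact h M hM
      have hflow : (∀ e, ¬ (O.addEvent X G l hG).Flow (Sum.inr e) (Sum.inl (Sum.inl b))) ↔
          ∀ e, ¬ O.Flow (Sum.inr e) (Sum.inl b) := by
        constructor
        · rintro h e ⟨v, hv⟩
          exact h (some e) ⟨v, inl_mem_map.2 hv⟩
        · intro h e hfl
          obtain ⟨x, hx, hfl⟩ := flow_old (y := Sum.inl b) hfl
          rcases x with b' | e'
          · cases hx
          · exact h e' hfl
      have hpost : ∀ ev : Option E × V, (Sum.inl b, ev.2) ∈ (O.addEvent X G l hG).post ev.1 ↔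
          ∃ e, ev.1 = some e ∧ (b, ev.2) ∈ O.post e := by
        rintro ⟨_ | e, v⟩
        · simp [addEvent]
        · simp [addEvent]
      have huniq : (∃! ev : Option E × V, (Sum.inl b, ev.2) ∈ (O.addEvent X G l hG).post ev.1) ↔
          ∃! ev : E × V, (b, ev.2) ∈ O.post ev.1 := by
        simp only [hpost]
        constructor
        · rintro ⟨⟨_, v⟩, ⟨e, rfl, he⟩, hu⟩
          refine ⟨(e, v), he, fun ev hev => ?_⟩
          have := hu (some ev.1, ev.2) ⟨ev.1, rfl, hev⟩
          simpa [Prod.ext_iff] using this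
        · rintro ⟨⟨e, v⟩, he, hu⟩
          refine ⟨(some e, v), ⟨e, rfl, he⟩, ?_⟩
          rintro ⟨_, v'⟩ ⟨e', rfl, he'⟩
          have := hu (e', v') he'
          simpa [Prod.ext_iff] using this
      have := hO.origin b
      rw [hflow, huniq]
      convert this using 2
      · convert hcount 1
      · convert hcount 0
    · refine Or.inr ⟨⟨?_, (none, l i), ?_, ?_⟩, ?_⟩
      · rintro _ ⟨M, -, rfl⟩
        dsimp only
        rw [hfst]
        convert Multiset.count_eq_zero_of_notMem ?_
        simp
      · simp [addEvent]
      · rintro ⟨_ | e, v⟩ hv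
        · simp [addEvent] at hv
          simp [hv]
        · exact absurd hv inr_notMem_map
      · rintro ⟨-, h⟩
        exact h none ⟨l i, by simp [addEvent]⟩

/-- An assignment for the given net and the values of the variables of the new event yield an
assignment for the extended net. -/
def assign (θ : IVar V B E → K) (σ : V → K) (l : ι → V) : IVar V (B ⊕ ι) (Option E) → K
  | .event (some e) v => θ (.event e v)
  | .event none v => σ v
  | .bot (Sum.inl b) => θ (.bot b)
  -- An arbitrary value: new conditions are never initial, so no predicate constrains this variable.
  | .bot (Sum.inr i) => σ (l i)

variable {θ : IVar V B E → K} {σ : V → K}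

theorem satBot (h : O.SatBot θ) : (O.addEvent X G l hG).SatBot (assign θ σ l) := by
  obtain ⟨M, hM, hθ⟩ := h
  refine ⟨_, ⟨M, hM, rfl⟩, ?_⟩
  rintro (b | i) k hk
  · refine hθ b k ?_
    simpa using hk
  · exact absurd hk inr_notMem_map

theorem assign_condVar (hO : O.IsOccurrenceNet) (hO' : (O.addEvent X G l hG).IsOccurrenceNet)
    (b : B) : assign θ σ l ((O.addEvent X G l hG).condVar (Sum.inl b)) = θ (O.condVar b) := by
  rcases hO.initial_or_produced b with hb | ⟨e, v, hb⟩
  · have hb' : (Sum.inl b : B ⊕ ι) ∈ (O.addEvent X G l hG).initConds := by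
      obtain ⟨M, hM, k, hk⟩ := hb
      exact ⟨_, ⟨M, hM, rfl⟩, k, by simpa using hk⟩
    rw [hO.condVar_of_initial hb, hO'.condVar_of_initial hb']
    rfl
  · have hb' : ((Sum.inl b : B ⊕ ι), v) ∈ (O.addEvent X G l hG).post (some e) :=
      inl_mem_map.2 hb
    rw [hO.condVar_of_mem_post hb, hO'.condVar_of_mem_post hb']
    rfl

theorem satLoc_some (hO : O.IsOccurrenceNet) (hO' : (O.addEvent X G l hG).IsOccurrenceNet)
    {e : E} (h : O.SatLoc θ e) : (O.addEvent X G l hG).SatLoc (assign θ σ l) (some e) := by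
  refine ⟨h.1, ?_⟩
  rintro (b | i) v hv
  · rw [assign_condVar hO hO']
    exact h.2 b v (inl_mem_map.1 hv)
  · exact absurd hv inr_notMem_map

theorem satLoc_none (hO : O.IsOccurrenceNet) (hO' : (O.addEvent X G l hG).IsOccurrenceNet)
    (hσ : G σ) (h : ∀ b v, (b, v) ∈ X → θ (O.condVar b) = σ v) :
    (O.addEvent X G l hG).SatLoc (assign θ σ l) none := by
  refine ⟨hσ, ?_⟩
  rintro (b | i) v hv
  · rw [assign_condVar hO hO']
    exact (h b v (inl_mem_map.1 hv)).symm
  · exact absurd hv inr_notMem_map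

theorem satPred_some (hO : O.IsOccurrenceNet) (hO' : (O.addEvent X G l hG).IsOccurrenceNet)
    {e : E} (h : O.SatPred θ e) : (O.addEvent X G l hG).SatPred (assign θ σ l) (some e) := by
  refine ⟨satBot h.1, fun e' he' => ?_⟩
  obtain ⟨e₀, rfl, hle⟩ := event_le_old he'
  exact satLoc_some hO hO' (h.2 e₀ hle)

theorem satPred_none (hO : O.IsOccurrenceNet) (hO' : (O.addEvent X G l hG).IsOccurrenceNet)
    {C : Set E} (hC : O.IsConfiguration C) (hθ : O.IsInstantiation C θ) (hσ : G σ)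
    (hX : ∀ b v, (b, v) ∈ X → b ∈ O.cut C ∧ θ (O.condVar b) = σ v) :
    (O.addEvent X G l hG).SatPred (assign θ σ l) none := by
  refine ⟨satBot hθ.1, fun e' he' => ?_⟩
  rcases event_le_none hO hC.closed (fun b v hb => (hX b v hb).1) he' with rfl | ⟨e₀, he₀, rfl⟩
  · exact satLoc_none hO hO' hσ fun b v hb => (hX b v hb).2
  · exact satLoc_some hO hO' ((hθ.2 e₀ he₀).2 e₀ .refl)

end addEvent

end HLNet

/-! ### Maximality and the existence of events -/

namespace BranchingProcess

variable {K V P T : Type u} {N : HLNet K V P T} {β : BranchingProcess N}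

theorem map_fst_mem_initConds {B E B' E' : Type u} {O : HLNet K V B E} {O' : HLNet K V B' E'}
    {f : B → B'} {g : E → E'} (h : O.IsInitialHom O' f g) {b : B} (hb : b ∈ O.initConds) :
    f b ∈ O'.initConds := by
  obtain ⟨M, hM, k, hk⟩ := hb
  refine ⟨M.map fun x => (f x.1, x.2), h.init_eq ▸ Set.mem_image_of_mem _ hM, k, ?_⟩
  exact Multiset.mem_map_of_mem (fun x : B × K => (f x.1, x.2)) hk

/-- An extension of an unfolding adds no events. -/
theorem IsUnfolding.surjective_of_prefix (hβ : β.IsUnfolding) {β' : BranchingProcess N}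
    {f : β.B → β'.B} {g : β.E → β'.E} (hf : Function.Injective f) (hg : Function.Injective g)
    (h : β.net.IsInitialHom β'.net f g) (hfB : β'.homB ∘ f = β.homB)
    (hgE : β'.homE ∘ g = β.homE) : Function.Surjective g := by
  -- Maximality embeds `β'` back into `β`. Once `g' ∘ g` is onto, injectivity of `g'` makes `g`
  -- onto.
  obtain ⟨f', g', hf', hg', h', -, hgE'⟩ := hβ β' ⟨f, g, hf, hg, h, hfB, hgE⟩
  have hsurj : Function.Surjective (g' ∘ g) := by
    refine surjective_of_endomorphism (f := f' ∘ f) (hf'.comp hf)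
      (fun b hb => map_fst_mem_initConds h' (map_fst_mem_initConds h hb)) ⟨?_, ?_, ?_⟩ ?_
    · intro e
      rw [h.guard_eq, h'.guard_eq]
      rfl
    · intro e
      simp [h'.pre_eq, h.pre_eq]
    · intro e
      simp [h'.post_eq, h.post_eq]
    · rw [← Function.comp_assoc, hgE', hgE]
  intro e'
  obtain ⟨e, he⟩ := hsurj (g' e')
  exact ⟨e, hg' he⟩

/-- The possible extensions of an unfolding are present in it. -/
theorem IsUnfolding.exists_event [Nonempty K] (hβ : β.IsUnfolding) {C : Set β.E}
    (hC : β.net.IsConfiguration C) {θ : IVar V β.B β.E → K} (hθ : β.net.IsInstantiation C θ)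
    {t : T} {σ : V → K} (hσ : N.IsMode t σ) {X : Multiset (β.B × V)}
    (hXt : N.pre t = X.map fun x => (β.homB x.1, x.2)) (hXn : (X.map Prod.fst).Nodup)
    (hX : ∀ b v, (b, v) ∈ X → b ∈ β.net.cut C ∧ θ (β.net.condVar b) = σ v) :
    ∃ e, β.net.pre e = X ∧ β.homE e = t := by
  classical
  by_contra hno
  -- One fresh condition per occurrence in the postset of `t`: arcs with multiplicity are split into
  -- single arcs.
  let l : (N.post t).ToType → V := fun i => i.1.2
  have hl : N.post t = Finset.univ.val.map fun i : (N.post t).ToType => (i.1.1, l i) :=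
    (Multiset.map_univ_coe (N.post t)).symm
  have hG : ∀ σ σ' : V → K, (∀ b v, (b, v) ∈ X → σ v = σ' v) → (∀ i, σ (l i) = σ' (l i)) →
      (N.guard t σ ↔ N.guard t σ') := by
    intro σ σ' h h'
    refine N.guard_congr t σ σ' ?_
    rintro p v (hp | hp)
    · rw [hXt] at hp
      obtain ⟨⟨b, v'⟩, hb, heq⟩ := Multiset.mem_map.1 hp
      obtain ⟨rfl, rfl⟩ := Prod.mk.inj heq
      exact h b _ hb
    · rw [hl] at hp
      obtain ⟨i, -, heq⟩ := Multiset.mem_map.1 hp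
      obtain ⟨rfl, rfl⟩ := Prod.mk.inj heq
      exact h' i
  let O' := β.net.addEvent X (N.guard t) l hG
  have hO' : O'.IsOccurrenceNet :=
    HLNet.addEvent.isOccurrenceNet β.occurrence hC (fun b v hb => (hX b v hb).1) hXn
  have hinj : ∀ {s s' : Multiset (β.B × V)},
      s.map (fun x => ((Sum.inl x.1 : β.B ⊕ (N.post t).ToType), x.2)) =
        s'.map (fun x => (Sum.inl x.1, x.2)) → s = s' := by
    intro s s' h
    refine Multiset.map_injective ?_ h
    rintro ⟨b, v⟩ ⟨b', v'⟩ h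
    simpa using h
  -- The assumption `hno` that the event is missing is what makes `inj` hold for the extension.
  let β' : BranchingProcess N :=
    { B := β.B ⊕ (N.post t).ToType
      E := Option β.E
      net := O'
      homB := Sum.elim β.homB fun i => i.1.1
      homE := fun e => e.elim t β.homE
      occurrence := hO'
      satisfiable := by
        rintro (_ | e)
        · exact ⟨_, HLNet.addEvent.satPred_none β.occurrence hO' hC hθ hσ hX⟩
        · obtain ⟨θ, hθ⟩ := β.satisfiable e
          exact ⟨_, HLNet.addEvent.satPred_some (σ := σ) β.occurrence hO' hθ⟩
      initial := by
        refine ⟨⟨?_, ?_, ?_⟩, ?_⟩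
        · rintro (_ | e)
          · rfl
          · exact β.initial.guard_eq e
        · rintro (_ | e)
          · simpa [O', HLNet.addEvent, Function.comp_def] using hXt
          · simpa [O', HLNet.addEvent, Function.comp_def] using β.initial.pre_eq e
        · rintro (_ | e)
          · simpa [O', HLNet.addEvent, Function.comp_def] using hl
          · simpa [O', HLNet.addEvent, Function.comp_def] using β.initial.post_eq e
        · rw [← β.initial.init_eq]
          simp only [O', HLNet.addEvent, Set.image_image, Multiset.map_map, Function.comp_def,
            Sum.elim_inl]
      inj := by
        rintro (_ | e) (_ | e') h h'
        · rfl
        · exact (hno ⟨e', (hinj h).symm, h'.symm⟩).elim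
        · exact (hno ⟨e, hinj h, h'⟩).elim
        · exact congrArg some (β.inj e e' (hinj h) h') }
  have hsurj : Function.Surjective (some : β.E → Option β.E) :=
    hβ.surjective_of_prefix (β' := β') (f := Sum.inl) (g := some) Sum.inl_injective
      (Option.some_injective _) ⟨⟨fun _ => rfl, fun _ => rfl, fun _ => rfl⟩, rfl⟩ rfl rfl
  obtain ⟨e, he⟩ := hsurj none
  cases he

/-- Enabledness lifts by matching the arcs into `t` with tokens of the cut; the matched conditions
form the preset of a possible event, which exists by maximality. -/
theorem IsUnfolding.enabled_iff [Nonempty K] (hβ : β.IsUnfolding) {C : Set β.E}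
    (hC : β.net.IsConfiguration C) (hf : (β.net.cut C).Finite) {θ : IVar V β.B β.E → K}
    (hθ : β.net.IsInstantiation C θ) {t : T} {σ : V → K} :
    N.Enabled (β.marking C θ) t σ ↔
      ∃ e, β.homE e = t ∧ β.net.Enabled (β.net.instCut C θ) e σ := by
  constructor
  · rintro ⟨hσ, hle⟩
    obtain ⟨r, hr, hrM, hrx⟩ := Multiset.exists_map_eq_of_map_le_map
      (fun x : P × V => (x.1, σ x.2)) (fun x : β.B × K => (β.homB x.1, x.2)) _ _ hle
    -- The condition comes from the matched token, the variable from the arc.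
    let X : Multiset (β.B × V) := r.map fun x => (x.2.1, x.1.2)
    have hXσ : X.map (fun x => (x.1, σ x.2)) = r.map Prod.snd := by
      rw [Multiset.map_map]
      refine Multiset.map_congr rfl fun x hx => ?_
      exact Prod.ext rfl (Prod.mk.inj (hrx x hx)).2
    have hXt : N.pre t = X.map fun x => (β.homB x.1, x.2) := by
      rw [← hr, Multiset.map_map]
      refine Multiset.map_congr rfl fun x hx => ?_
      exact Prod.ext (Prod.mk.inj (hrx x hx)).1 rfl
    have hXn : (X.map Prod.fst).Nodup := by
      have h : X.map Prod.fst = (r.map Prod.snd).map Prod.fst := by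
        simp [X, Multiset.map_map]
      rw [h]
      exact Multiset.nodup_of_le (Multiset.map_le_map hrM) (HLNet.nodup_map_fst_instCut hf)
    have hX : ∀ b v, (b, v) ∈ X → b ∈ β.net.cut C ∧ θ (β.net.condVar b) = σ v := by
      intro b v hb
      rw [← HLNet.mem_instCut hf]
      refine Multiset.mem_of_le hrM ?_
      rw [← hXσ]
      exact Multiset.mem_map_of_mem (fun x : β.B × V => (x.1, σ x.2)) hb
    obtain ⟨e, he, rfl⟩ := hβ.exists_event hC hθ hσ hXt hXn hX
    refine ⟨e, rfl, ?_, ?_⟩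
    · rw [HLNet.IsMode, β.initial.guard_eq]
      exact hσ
    · rw [HLNet.preMode, he, hXσ]
      exact hrM
  · rintro ⟨e, rfl, he⟩
    exact β.initial.enabled he

/-! ### Firing sequences and finite configurations -/

/-- Firing in the occurrence net and in the original net agree. -/
theorem marking_insert {C : Set β.E} (hf : (β.net.cut C).Finite)
    (hcl : ∀ e ∈ C, ∀ e', β.net.Le (Sum.inr e') (Sum.inr e) → e' ∈ C)
    {θ : IVar V β.B β.E → K} {e : β.E} (he : e ∉ C)
    (hpre : β.net.preMode e (fun v => θ (IVar.event e v)) ≤ β.net.instCut C θ) :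
    β.marking (insert e C) θ =
      N.fire (β.marking C θ) (β.homE e) fun v => θ (IVar.event e v) := by
  rw [marking, (HLNet.instCut_insert β.occurrence hf hcl he hpre).2, β.initial.fire_eq hpre]
  rfl

/-- A conflict involving `e` would need an input of `e` that `C` consumes, but the inputs of `e` are
in the cut. -/
theorem isConfiguration_insert {C : Set β.E} (hC : β.net.IsConfiguration C)
    {e : β.E} (hpre : ∀ b v, (b, v) ∈ β.net.pre e → b ∈ β.net.cut C)
    (hθ : ∃ θ : IVar V β.B β.E → K, ∀ e' ∈ insert e C, β.net.SatPred θ e') :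
    β.net.IsConfiguration (insert e C) := by
  have hle : ∀ e' ∈ insert e C, ∀ t, β.net.Le (Sum.inr t) (Sum.inr e') → t = e ∨ t ∈ C := by
    rintro e' (rfl | he') t ht
    · exact β.occurrence.eq_or_mem_of_le hC.closed hpre ht
    · exact Or.inr (hC.closed e' he' t ht)
  refine ⟨?_, hθ, fun e' he' t ht => hle e' he' t ht⟩
  rintro e₁ h₁ e₂ h₂ ⟨p, t, t', hne, hp, hp', ht, ht'⟩
  rcases hle e₁ h₁ t ht with rfl | htC <;> rcases hle e₂ h₂ t' ht' with rfl | htC'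
  · exact hne rfl
  · obtain ⟨v, hv⟩ := hp
    exact (hpre p v hv).2 ⟨t', htC', hp'⟩
  · obtain ⟨v, hv⟩ := hp'
    exact (hpre p v hv).2 ⟨t, htC, hp⟩
  · exact hC.no_conflict t htC t' htC' ⟨p, t, t', hne, hp, hp', .refl, .refl⟩

open Classical in
/-- The assignment obtained by giving the variables of `e` the values `σ`. -/
noncomputable def assignEvent {B E : Type u} (θ : IVar V B E → K) (e : E) (σ : V → K) :
    IVar V B E → K
  | .event e' v => if e' = e then σ v else θ (.event e' v)
  | .bot b => θ (.bot b)

theorem assignEvent_self {B E : Type u} (θ : IVar V B E → K) (e : E) (σ : V → K) :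
    (fun v => assignEvent θ e σ (.event e v)) = σ := by
  funext v
  simp [assignEvent]

theorem assignEvent_of_ne {B E : Type u} (θ : IVar V B E → K) {e e' : E} (σ : V → K)
    (h : e' ≠ e) (v : V) : assignEvent θ e σ (.event e' v) = θ (.event e' v) := by
  simp [assignEvent, h]

theorem assignEvent_condVar {θ : IVar V β.B β.E → K} {e : β.E} {σ : V → K} {b : β.B}
    (h : ¬ β.net.Flow (Sum.inr e) (Sum.inl b)) :
    assignEvent θ e σ (β.net.condVar b) = θ (β.net.condVar b) := by
  rcases β.occurrence.initial_or_produced b with hb | ⟨e', v, hb⟩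
  · rw [β.occurrence.condVar_of_initial hb]
    rfl
  · rw [β.occurrence.condVar_of_mem_post hb, assignEvent_of_ne]
    rintro rfl
    exact h ⟨v, hb⟩

/-- An event enabled at an instantiated cut extends the instantiated configuration. -/
theorem exists_insert {C : Set β.E} (hC : β.net.IsConfiguration C)
    (hf : (β.net.cut C).Finite) {θ : IVar V β.B β.E → K} (hθ : β.net.IsInstantiation C θ)
    {e : β.E} {σ : V → K} (he : β.net.Enabled (β.net.instCut C θ) e σ) (heC : e ∉ C) :
    ∃ θ' : IVar V β.B β.E → K, β.net.IsConfiguration (insert e C) ∧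
      β.net.IsInstantiation (insert e C) θ' ∧
      β.marking (insert e C) θ' = N.fire (β.marking C θ) (β.homE e) σ := by
  have hpre : ∀ b v, (b, v) ∈ β.net.pre e → b ∈ β.net.cut C ∧ θ (β.net.condVar b) = σ v :=
    fun b v hb => HLNet.mem_cut_of_enabled hf he.2 hb
  have hcond : ∀ b ∈ β.net.cut C,
      θ (β.net.condVar b) = assignEvent θ e σ (β.net.condVar b) := fun b hb =>
    (assignEvent_condVar fun h => heC (β.occurrence.mem_of_mem_cut hb h)).symm
  have hbot : β.net.SatBot (assignEvent θ e σ) := hθ.1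
  have hlocC : ∀ e' ∈ C, β.net.SatLoc (assignEvent θ e σ) e' := by
    intro e' he'
    have hne : e' ≠ e := fun h => heC (h ▸ he')
    have h := (hθ.2 e' he').2 e' .refl
    simp only [HLNet.SatLoc, assignEvent_of_ne θ σ hne]
    refine ⟨h.1, fun b v hb => ?_⟩
    rw [assignEvent_condVar, h.2 b v hb]
    -- Reassigning the variables of `e` does not affect `C`: an event of `C` using an output of `e`
    -- would force `e` into `C`.
    exact fun hfl => heC (hC.closed e' he' e (HLNet.le_of_post_pre hfl ⟨v, hb⟩))
  have hloce : β.net.SatLoc (assignEvent θ e σ) e := by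
    refine ⟨?_, fun b v hb => ?_⟩
    · rw [assignEvent_self]
      exact he.1
    · rw [← hcond b (hpre b v hb).1, (hpre b v hb).2]
      exact congrFun (assignEvent_self θ e σ) v
  have hsat : ∀ e' ∈ insert e C, β.net.SatPred (assignEvent θ e σ) e' := by
    rintro e' (rfl | he')
    · refine ⟨hbot, fun t ht => ?_⟩
      rcases β.occurrence.eq_or_mem_of_le hC.closed (fun b v hb => (hpre b v hb).1) ht
        with rfl | ht
      · exact hloce
      · exact hlocC t ht
    · exact ⟨hbot, fun t ht => hlocC t (hC.closed e' he' t ht)⟩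
  refine ⟨assignEvent θ e σ, isConfiguration_insert hC (fun b v hb => (hpre b v hb).1) ⟨_, hsat⟩,
    ⟨hbot, hsat⟩, ?_⟩
  have hcut := HLNet.instCut_congr hcond
  rw [marking_insert hf hC.closed heC, assignEvent_self, marking, marking, hcut]
  rw [assignEvent_self, ← hcut]
  exact he.2

/-- Induction along the firing sequence: each step is lifted to an event enabled at the current cut,
which is then added to the configuration. -/
theorem exists_marking_of_reachable [Nonempty K] (hβ : β.IsUnfolding)
    (hN : ∀ (t : T) (σ : V → K), N.IsMode t σ → N.pre t = 0 → N.post t = 0)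
    {M : Multiset (P × K)} (hM : N.Reachable M) :
    ∃ (C : Set β.E) (θ : IVar V β.B β.E → K), C.Finite ∧ β.net.IsConfiguration C ∧
      β.net.IsInstantiation C θ ∧ M = β.marking C θ := by
  induction hM with
  | @init M hM =>
    rw [← β.initial.init_eq] at hM
    obtain ⟨M, hM, rfl⟩ := hM
    obtain ⟨θ, hθ⟩ := HLNet.exists_assignment_of_init β.occurrence hM
    refine ⟨∅, θ, Set.finite_empty, ⟨by simp, ⟨θ, by simp⟩, by simp⟩, ⟨⟨M, hM, hθ⟩, by simp⟩, ?_⟩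
    rw [marking, HLNet.instCut_empty β.occurrence hM hθ]
  | @step M t σ hM ht ih =>
    obtain ⟨C, θ, hfin, hC, hθ, rfl⟩ := ih
    have hf := β.net.finite_cut hfin
    obtain ⟨e, rfl, he⟩ := (hβ.enabled_iff hC hf hθ).1 ht
    by_cases heC : e ∈ C
    -- An event of `C` has consumed its inputs, so it can be enabled again only if it has none. Then
    -- firing it leaves the marking unchanged by `hN`.
    · have hpre : β.net.pre e = 0 := by
        refine Multiset.eq_zero_of_forall_notMem ?_
        rintro ⟨b, v⟩ hb
        exact (HLNet.mem_cut_of_enabled hf he.2 hb).1.2 ⟨e, heC, v, hb⟩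
      have hpre' : N.pre (β.homE e) = 0 := by rw [β.initial.pre_eq, hpre, Multiset.map_zero]
      refine ⟨C, θ, hfin, hC, hθ, ?_⟩
      rw [HLNet.fire, HLNet.preMode, HLNet.postMode, hpre', hN _ σ ht.1 hpre']
      simp
    · obtain ⟨θ', hC', hθ', h⟩ := exists_insert hC hf hθ he heC
      exact ⟨insert e C, θ', hfin.insert e, hC', hθ', h.symm⟩

/-- Induction on the size of `C`: a causally maximal event is removed, and the remaining
configuration enables it. -/
theorem reachable_marking {C : Set β.E} (hfin : C.Finite) (hC : β.net.IsConfiguration C)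
    {θ : IVar V β.B β.E → K} (hθ : β.net.IsInstantiation C θ) :
    N.Reachable (β.marking C θ) := by
  induction hn : C.ncard generalizing C with
  | zero =>
    rw [Set.ncard_eq_zero hfin] at hn
    subst hn
    obtain ⟨M, hM, hMθ⟩ := hθ.1
    rw [marking, HLNet.instCut_empty β.occurrence hM hMθ]
    exact .init (β.initial.init_eq ▸ Set.mem_image_of_mem _ hM)
  | succ n ih =>
    have hne : C.Nonempty := by
      rw [Set.nonempty_iff_ne_empty]
      rintro rfl
      simp at hn
    -- Causality is reversed, so a minimal element for `r` is a causally maximal event.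
    let r : β.E → β.E → Prop := fun e' e => β.net.Lt (Sum.inr e) (Sum.inr e')
    have : IsStrictOrder β.E r :=
      { irrefl := fun _ => β.occurrence.irrefl _
        trans := fun _ _ _ h h' => Relation.TransGen.trans h' h }
    obtain ⟨e, he, hmax⟩ : ∃ e ∈ C, ∀ e' ∈ C, ¬ β.net.Lt (Sum.inr e) (Sum.inr e') := by
      obtain ⟨e, -, hmin⟩ := (hfin.wellFoundedOn (r := r)).has_min Set.univ
        ⟨⟨hne.some, hne.some_mem⟩, trivial⟩
      exact ⟨e.1, e.2, fun e' he' => hmin ⟨e', he'⟩ trivial⟩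
    have hsub : C \ {e} ⊆ C := Set.sdiff_subset
    have hins : insert e (C \ {e}) = C := Set.insert_sdiff_self_of_mem he
    have hC' : β.net.IsConfiguration (C \ {e}) := by
      refine ⟨fun a ha b hb => hC.no_conflict a (hsub ha) b (hsub hb),
        ⟨θ, fun a ha => hθ.2 a (hsub ha)⟩, fun a ha a' hle => ⟨hC.closed a ha.1 a' hle, ?_⟩⟩
      rintro rfl
      rcases Relation.reflTransGen_iff_eq_or_transGen.1 hle with h | h
      · exact ha.2 (Sum.inr.inj h)
      · exact hmax a ha.1 h
    have hθ' : β.net.IsInstantiation (C \ {e}) θ := ⟨hθ.1, fun a ha => hθ.2 a (hsub ha)⟩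
    have hf := β.net.finite_cut (hfin.subset hsub)
    have hloc := (hθ.2 e he).2 e .refl
    -- Inputs of `e` are initial or produced by its causes in `C`, and no other event of `C`
    -- consumes them because `C` is conflict-free.
    have hpre : β.net.preMode e (fun v => θ (.event e v)) ≤ β.net.instCut (C \ {e}) θ := by
      refine HLNet.preMode_le_instCut β.occurrence hf fun b v hb => ⟨⟨?_, ?_⟩, (hloc.2 b v hb).symm⟩
      · rcases β.occurrence.initial_or_produced b with h | ⟨e', v', h⟩
        · exact Or.inl h
        · refine Or.inr ⟨e', ⟨hC.closed e he e' (HLNet.le_of_post_pre ⟨v', h⟩ ⟨v, hb⟩), ?_⟩, v', h⟩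
          rintro rfl
          exact β.occurrence.irrefl (Sum.inr e')
            ((Relation.TransGen.single (b := Sum.inl b) ⟨v', h⟩).tail ⟨v, hb⟩)
      · rintro ⟨e', he', hfl⟩
        exact hC.no_conflict e he e' he'.1
          ⟨b, e, e', fun h => he'.2 h.symm, ⟨v, hb⟩, hfl, .refl, .refl⟩
    have hmark := marking_insert hf hC'.closed (fun h => h.2 rfl) hpre
    rw [hins] at hmark
    rw [hmark]
    refine .step (ih (hfin.subset hsub) hC' hθ' ?_) (β.initial.enabled ⟨hloc.1, hpre⟩)
    rw [Set.ncard_sdiff_singleton_of_mem he, hn, Nat.add_sub_cancel]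

end BranchingProcess

theorem mainTheorem9 {K V P T : Type u} [Nonempty K] (N : HLNet K V P T)
    (β : BranchingProcess N) (hβ : β.IsUnfolding) :
    ((∀ (t : T) (σ : V → K), N.IsMode t σ → N.pre t = 0 → N.post t = 0) →
      {M | N.Reachable M} =
        {M | ∃ (C : Set β.E) (θ : IVar V β.B β.E → K), C.Finite ∧ β.net.IsConfiguration C ∧
          β.net.IsInstantiation C θ ∧ M = β.marking C θ}) ∧
    (∀ (C : Set β.E), β.net.IsConfiguration C → (β.net.cut C).Finite →
      ∀ (θ : IVar V β.B β.E → K), β.net.IsInstantiation C θ →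
      ∀ (t : T) (σ : V → K), N.IsMode t σ →
        (N.Enabled (β.marking C θ) t σ ↔
          ∃ e : β.E, β.homE e = t ∧ β.net.Enabled (β.net.instCut C θ) e σ)) := by
  refine ⟨fun hN => Set.Subset.antisymm (fun M hM => ?_) ?_, ?_⟩
  · exact BranchingProcess.exists_marking_of_reachable hβ hN hM
  · rintro _ ⟨C, θ, hfin, hC, hθ, rfl⟩
    exact BranchingProcess.reachable_marking hfin hC hθ
  · intro C hC hf θ hθ t σ _
    exact hβ.enabled_iff hC hf hθ
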